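/- **Theorem.** Let $B>0$, $I=[0,B]$, and let $L^2(I)$ be the real Hilbert space of square integrable functions on $I$ with inner product $\langle\cdot,\cdot\rangle$. For $f\in L^2(I)$ and $\xi\in I$ set $$\gamma f(\xi)=\int_I (x-\xi)^+f(x)\,dx,\qquad \gamma^*f(\xi)=\int_I(\xi-x)^+f(x)\,dx$$ (the restricted call and put operators on $L^2(I)$). We say that $g:I\to\mathbb R$ is *twice differentiable with second derivative* $\partial^2 g=v$ if $g$ is continuously differentiable on $I$, $g'$ is absolutely continuous on $I$, and $g''(\xi)$ exists and equals $v(\xi)$ for almost every $\xi\in I$. A *spectral system* is a triple $(\lambda_k)_{k\ge0},(\phi_k)_{k\ge0},(\psi_k)_{k\ge0}$, where $(\lambda_k)$ is a decreasing (not necessarily strictly) sequence of positive numbers, $(\phi_k)$ and $(\psi_k)$ are orthonormal families in $L^2(I)$ with $\gamma^*\gamma\phi_k=\lambda_k^2\phi_k$ and $\gamma\gamma^*\psi_k=\lambda_k^2\psi_k$ for all $k$, the range of $\gamma^*\gamma$ is contained in the closed linear span of $(\phi_k)$, and the range of $\gamma\gamma^*$ in that of $(\psi_k)$. Then the following hold.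 1. $\gamma^*$ is the adjoint of $\gamma$. There is a spectral system with $(\lambda_k)$ strictly decreasing and $$\gamma\phi_k=\lambda_k\psi_k,\qquad \gamma^*\psi_k=\lambda_k\phi_k\qquad(k\ge0).\tag{1}$$ Moreover, (1) holds for every spectral system whose signs are chosen so that $\langle\gamma\phi_k,\psi_k\rangle\ge0$ for all $k$. 2. For every $f\in L^2(I)$ the functions $\gamma f$ and $\gamma^*f$ are twice differentiable on $I$ in the above sense. If $f$ agrees almost everywhere on $I$ with a function $h$ that is continuous on $I$, then $\gamma f$ and $\gamma^*f$ are in the classical sense twice continuously differentiable on $I$ (one-sided derivatives at the endpoints), with second derivative $h$ at every point of $I$. 3. The ranges of $\gamma$ and of $\gamma^*$ are dense in $L^2(I)$. Both operators are injective, and on their ranges $\partial^2$ is their inverse: for every $f\in L^2(I)$, $$\partial^2\gamma f=\partial^2\gamma^*f=f$$ (the Breeden–Litzenberger formula restricted to $I$), and $\gamma\,\partial^2u=u$ for every $u$ in the range of $\gamma$, and $\gamma^*\partial^2u=u$ for every $u$ in the range of $\gamma^*$. 4. For every spectral system with $\langle\gamma\phi_k,\psi_k\rangle\ge0$ for all $k$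 and every $f\in L^2(I)$, with convergence in $L^2(I)$, $$f=\sum_{k\ge0}\langle f,\phi_k\rangle\phi_k,\quad \gamma f=\sum_{k\ge0}\lambda_k\langle f,\phi_k\rangle\psi_k,\quad f=\sum_{k\ge0}\langle f,\psi_k\rangle\psi_k,\quad \gamma^*f=\sum_{k\ge0}\lambda_k\langle f,\psi_k\rangle\phi_k .$$ 5. (Put–call parity on the interval.) For every $f\in L^2(I)$ and every $\xi\in I$, $$(\gamma-\gamma^*)f(\xi)=\bar m_1(f)-\xi\,\bar m_0(f),\qquad \bar m_k(f)=\int_I x^kf(x)\,dx .$$ -/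

import Mathlib

open MeasureTheory Set

/-- Lebesgue measure on the interval `[0, B]`. -/
noncomputable abbrev intervalMeasure (B : ℝ) : Measure ℝ := volume.restrict (Icc 0 B)

/-- The real Hilbert space `L²[0, B]`. -/
noncomputable abbrev L2I (B : ℝ) := Lp ℝ 2 (intervalMeasure B)

/-- The call kernel `θ(ξ, x) = (x - ξ)⁺`. -/
noncomputable def callKernel (ξ x : ℝ) : ℝ := max (x - ξ) 0

/-- The put kernel `θ*(ξ, x) = θ(x, ξ) = (ξ - x)⁺`. -/
noncomputable def putKernel (ξ x : ℝ) : ℝ := callKernel x ξ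

/-- The function `ξ ↦ ∫_{[0,B]} K(ξ, x) f(x) dx`. -/
noncomputable def kernelFun (B : ℝ) (K : ℝ → ℝ → ℝ) (f : ℝ → ℝ) (ξ : ℝ) : ℝ :=
  ∫ x in Icc 0 B, K ξ x * f x

/-- The function `ξ ↦ ∫_{[0,B]} (x - ξ)⁺ f(x) dx`, defined pointwise. -/
noncomputable def callFun (B : ℝ) (f : ℝ → ℝ) : ℝ → ℝ := kernelFun B callKernel f

/-- The function `ξ ↦ ∫_{[0,B]} (ξ - x)⁺ f(x) dx`, defined pointwise. -/
noncomputable def putFun (B : ℝ) (f : ℝ → ℝ) : ℝ → ℝ := kernelFun B putKernel f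

theorem L2I.integrable {B : ℝ} (f : L2I B) : Integrable f (intervalMeasure B) :=
  (Lp.memLp f).integrable (by norm_num)

theorem kernelFun_integrable {B : ℝ} {K : ℝ → ℝ → ℝ} (hK : Continuous (Function.uncurry K))
    (f : L2I B) (ξ : ℝ) : Integrable (fun x => K ξ x * f x) (intervalMeasure B) := by
  have hc : Continuous (K ξ) := hK.comp (by fun_prop : Continuous fun x : ℝ => (ξ, x))
  exact IntegrableOn.continuousOn_mul hc.continuousOn (L2I.integrable f) isCompact_Icc

theorem kernelFun_memLp {B : ℝ} {K : ℝ → ℝ → ℝ} (hK : Continuous (Function.uncurry K))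
    (f : L2I B) : MemLp (kernelFun B K f) 2 (intervalMeasure B) := by
  obtain ⟨C, hC⟩ := (isCompact_Icc.prod isCompact_Icc :
    IsCompact (Icc (0 : ℝ) B ×ˢ Icc (0 : ℝ) B)).exists_bound_of_continuousOn hK.continuousOn
  have hm : StronglyMeasurable (kernelFun B K f) := by
    have h : StronglyMeasurable (Function.uncurry fun ξ x => K ξ x * f x) :=
      hK.stronglyMeasurable.mul ((Lp.stronglyMeasurable f).comp_measurable measurable_snd)
    exact h.integral_prod_right
  refine MemLp.of_bound hm.aestronglyMeasurable (∫ x in Icc 0 B, C * ‖f x‖) ?_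
  filter_upwards [ae_restrict_mem measurableSet_Icc] with ξ hξ
  refine norm_integral_le_of_norm_le ((L2I.integrable f).norm.const_mul C) ?_
  filter_upwards [ae_restrict_mem measurableSet_Icc] with x hx
  rw [norm_mul]
  exact mul_le_mul_of_nonneg_right (hC (ξ, x) ⟨hξ, hx⟩) (norm_nonneg _)

/-- The linear operator of `L²[0, B]` with a continuous kernel. -/
noncomputable def kernelLin (B : ℝ) (K : ℝ → ℝ → ℝ) (hK : Continuous (Function.uncurry K)) :
    L2I B →ₗ[ℝ] L2I B where
  toFun f := (kernelFun_memLp hK f).toLp (kernelFun B K f)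
  map_add' f g := by
    rw [← MemLp.toLp_add]
    congr 1
    funext ξ
    simp only [Pi.add_apply, kernelFun]
    rw [← integral_add (kernelFun_integrable hK f ξ) (kernelFun_integrable hK g ξ)]
    refine integral_congr_ae ?_
    filter_upwards [Lp.coeFn_add f g] with x hx
    rw [hx, Pi.add_apply, mul_add]
  map_smul' c f := by
    rw [RingHom.id_apply, ← MemLp.toLp_const_smul]
    congr 1
    funext ξ
    simp only [Pi.smul_apply, kernelFun, smul_eq_mul]
    rw [← integral_const_mul]
    refine integral_congr_ae ?_
    filter_upwards [Lp.coeFn_smul c f] with x hx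
    rw [hx, Pi.smul_apply, smul_eq_mul]
    ring

theorem kernelLin_bound (B : ℝ) (K : ℝ → ℝ → ℝ) (hK : Continuous (Function.uncurry K)) :
    ∃ C : ℝ, ∀ f : L2I B, ‖kernelLin B K hK f‖ ≤ C * ‖f‖ := by
  obtain ⟨C, hC⟩ := (isCompact_Icc.prod isCompact_Icc :
    IsCompact (Icc (0 : ℝ) B ×ˢ Icc (0 : ℝ) B)).exists_bound_of_continuousOn hK.continuousOn
  obtain ⟨M, hM0, hM⟩ : ∃ M : ℝ, 0 ≤ M ∧ ∀ f : L2I B, ∫ x in Icc 0 B, ‖f x‖ ≤ M * ‖f‖ := by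
    refine ⟨((intervalMeasure B univ) ^ (1 / (1 : ENNReal).toReal - 1 / (2 : ENNReal).toReal)).toReal,
      ENNReal.toReal_nonneg, fun f => ?_⟩
    have h := eLpNorm_le_eLpNorm_mul_rpow_measure_univ (μ := intervalMeasure B)
      (p := 1) (q := 2) (by norm_num) (Lp.aestronglyMeasurable f)
    have hfin : (intervalMeasure B univ) ^
        (1 / (1 : ENNReal).toReal - 1 / (2 : ENNReal).toReal) ≠ ⊤ :=
      ENNReal.rpow_ne_top_of_nonneg (by norm_num) (measure_ne_top _ _)
    have h2 := ENNReal.toReal_mono (ENNReal.mul_ne_top (Lp.eLpNorm_ne_top f) hfin) h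
    rw [ENNReal.toReal_mul, ← Lp.norm_def] at h2
    rw [integral_norm_eq_lintegral_enorm (Lp.aestronglyMeasurable f), ← eLpNorm_one_eq_lintegral_enorm]
    linarith
  refine ⟨(measureUnivNNReal (intervalMeasure B)) ^ (2 : ENNReal).toReal⁻¹ * (max C 0 * M),
    fun f => ?_⟩
  have hI : (0 : ℝ) ≤ ∫ x in Icc 0 B, ‖f x‖ := integral_nonneg fun _ => norm_nonneg _
  have hle : ‖kernelLin B K hK f‖ ≤ (measureUnivNNReal (intervalMeasure B)) ^ (2 : ENNReal).toReal⁻¹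
      * (max C 0 * ∫ x in Icc 0 B, ‖f x‖) := by
    refine Lp.norm_le_of_ae_bound (mul_nonneg (le_max_right _ _) hI) ?_
    filter_upwards [(kernelFun_memLp hK f).coeFn_toLp, ae_restrict_mem measurableSet_Icc] with ξ h1 hξ
    have h1' : (kernelLin B K hK f) ξ = kernelFun B K f ξ := h1
    rw [h1', ← integral_const_mul]
    refine norm_integral_le_of_norm_le ((L2I.integrable f).norm.const_mul _) ?_
    filter_upwards [ae_restrict_mem measurableSet_Icc] with x hx
    rw [norm_mul]
    exact mul_le_mul_of_nonneg_right ((hC (ξ, x) ⟨hξ, hx⟩).trans (le_max_left _ _)) (norm_nonneg _)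
  refine hle.trans ?_
  rw [mul_assoc, mul_assoc]
  gcongr
  exact hM f

/-- The bounded operator of `L²[0, B]` with a continuous kernel. -/
noncomputable def kernelOp (B : ℝ) (K : ℝ → ℝ → ℝ) (hK : Continuous (Function.uncurry K)) :
    L2I B →L[ℝ] L2I B :=
  ⟨kernelLin B K hK, by
    obtain ⟨C, hC⟩ := kernelLin_bound B K hK
    exact AddMonoidHomClass.continuous_of_bound (kernelLin B K hK) C hC⟩

theorem continuous_callKernel : Continuous (Function.uncurry callKernel) := by
  unfold callKernel Function.uncurry
  fun_prop

theorem continuous_putKernel : Continuous (Function.uncurry putKernel) := by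
  unfold putKernel callKernel Function.uncurry
  fun_prop

/-- The restricted call operator `γ` on `L²[0, B]`. -/
noncomputable def callOp (B : ℝ) : L2I B →L[ℝ] L2I B :=
  kernelOp B callKernel continuous_callKernel

/-- The restricted put operator `γ*` on `L²[0, B]`. -/
noncomputable def putOp (B : ℝ) : L2I B →L[ℝ] L2I B :=
  kernelOp B putKernel continuous_putKernel

theorem callOp_coeFn (B : ℝ) (f : L2I B) : callOp B f =ᵐ[intervalMeasure B] callFun B f :=
  MemLp.coeFn_toLp (kernelFun_memLp continuous_callKernel f)

theorem putOp_coeFn (B : ℝ) (f : L2I B) : putOp B f =ᵐ[intervalMeasure B] putFun B f :=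
  MemLp.coeFn_toLp (kernelFun_memLp continuous_putKernel f)

/-- The partial moment `m̄_k(f) = ∫_{[0,B]} x^k f(x) dx`. -/
noncomputable def partialMoment (B : ℝ) (k : ℕ) (f : ℝ → ℝ) : ℝ := ∫ x in Icc 0 B, x ^ k * f x

/-- `g` is twice differentiable on `[0, B]` in the sense of Lebesgue, with second derivative `v`:
it is continuously differentiable on `[0, B]` (one-sided derivatives at the endpoints), its
derivative is absolutely continuous on `[0, B]`, and the derivative of that derivative exists and
equals `v` at almost every point of `[0, B]`. -/
def HasSecondDerivOn (B : ℝ) (g v : ℝ → ℝ) : Prop :=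
  ContDiffOn ℝ 1 g (Icc 0 B) ∧
  AbsolutelyContinuousOnInterval (derivWithin g (Icc 0 B)) 0 B ∧
  ∀ᵐ ξ ∂(intervalMeasure B), HasDerivWithinAt (derivWithin g (Icc 0 B)) (v ξ) (Icc 0 B) ξ

/-- The data given by the spectral theorem for `γ*γ` and `γγ*`: a decreasing sequence of positive
numbers `lam k` and orthonormal families of eigenvectors `φ k` of `γ*γ` and `ψ k` of `γγ*`, both for
the eigenvalues `(lam k)²`, that are complete in the ranges of `γ*γ` and of `γγ*`. -/
structure IsSpectralSystem (B : ℝ) (lam : ℕ → ℝ) (φ ψ : ℕ → L2I B) : Prop where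
  pos : ∀ k, 0 < lam k
  anti : Antitone lam
  orthonormal_left : Orthonormal ℝ φ
  orthonormal_right : Orthonormal ℝ ψ
  eigen_left : ∀ k, putOp B (callOp B (φ k)) = (lam k ^ 2) • φ k
  eigen_right : ∀ k, callOp B (putOp B (ψ k)) = (lam k ^ 2) • ψ k
  complete_left : ∀ f : L2I B,
    putOp B (callOp B f) ∈ (Submodule.span ℝ (range φ)).topologicalClosure
  complete_right : ∀ f : L2I B,
    callOp B (putOp B f) ∈ (Submodule.span ℝ (range ψ)).topologicalClosure

/-! The put kernel is a Green's function of the second derivative: `γ* f` has derivative `∫₀^ξ f`,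
hence second derivative `f` (`hasDerivAt_putFun`). By put-call parity `γ f` differs from `γ* f` by
an affine function, so it has the same second derivative. Both operators are therefore injective; as
they are adjoint to each other by Fubini, injectivity of one gives dense range of the other.

Sampling `γ f` on a uniform grid approximates `γ` in operator norm by finite-rank operators, so `γ`
is compact (`isCompactOperator_callOp`) and the spectral theorem applies to `γ*γ`.

The heart is the simplicity of the eigenvalues (`eq_zero_of_eigen_of_partialMoment_eq_zero`). Let
`γ*γ f = c f` with `c > 0` and zeroth moment `0`. Parity then says that `w = γ f` solves `w = b +
c⁻¹ γ*γ* w` with a constant `b`. If `b ≠ 0`, then `w` keeps the sign of `b` on the whole interval,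
against `w B = 0`; if `b = 0`, this is a homogeneous Volterra equation and `w = 0`. So the zeroth
moment is injective on each eigenspace, which is at most a line. Consequently `γ φ_k` is a multiple
of `ψ_k`, the factor is `± λ_k`, and the choice of signs makes it `λ_k`. The expansions follow
because the dense ranges make both families complete. -/

/-! ### Put-call parity -/

theorem integrable_callKernel_mul {B : ℝ} {f : ℝ → ℝ} (hf : Integrable f (intervalMeasure B))
    (ξ : ℝ) : Integrable (fun x => callKernel ξ x * f x) (intervalMeasure B) :=
  IntegrableOn.continuousOn_mul (by unfold callKernel; fun_prop) hf isCompact_Icc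

theorem integrable_putKernel_mul {B : ℝ} {f : ℝ → ℝ} (hf : Integrable f (intervalMeasure B))
    (ξ : ℝ) : Integrable (fun x => putKernel ξ x * f x) (intervalMeasure B) :=
  IntegrableOn.continuousOn_mul (by unfold putKernel callKernel; fun_prop) hf isCompact_Icc

/-- Put-call parity on the interval. -/
theorem callFun_sub_putFun {B : ℝ} {f : ℝ → ℝ} (hf : Integrable f (intervalMeasure B)) (ξ : ℝ) :
    callFun B f ξ - putFun B f ξ = partialMoment B 1 f - ξ * partialMoment B 0 f := by
  have h1 : Integrable (fun x => x ^ 1 * f x) (intervalMeasure B) :=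
    IntegrableOn.continuousOn_mul (by fun_prop) hf isCompact_Icc
  have h0 : Integrable (fun x => x ^ 0 * f x) (intervalMeasure B) := by simpa using hf
  unfold callFun putFun kernelFun partialMoment
  rw [← integral_const_mul, ← integral_sub (integrable_callKernel_mul hf ξ)
    (integrable_putKernel_mul hf ξ), ← integral_sub h1 (h0.const_mul ξ)]
  refine integral_congr_ae (Filter.Eventually.of_forall fun x => ?_)
  simp only [putKernel, callKernel]
  rcases le_total x ξ with h | h
  · rw [max_eq_right (by linarith), max_eq_left (by linarith)]; ring
  · rw [max_eq_left (by linarith), max_eq_right (by linarith)]; ring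

/-! ### Derivatives of `γ f` and `γ* f` -/

theorem intervalIntegrable_of_integrable {B : ℝ} (hB : 0 ≤ B) {f : ℝ → ℝ}
    (hf : Integrable f (intervalMeasure B)) : IntervalIntegrable f volume 0 B :=
  (intervalIntegrable_iff_integrableOn_Icc_of_le hB).2 hf

theorem abs_putKernel_sub_le (x ξ η : ℝ) : |putKernel ξ x - putKernel η x| ≤ |ξ - η| := by
  unfold putKernel callKernel
  simpa using abs_max_sub_max_le_abs (ξ - x) (η - x) 0

/-- Differentiation under the integral sign: the put kernel is 1-Lipschitz in `ξ`, which gives the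
dominating function `|f|`, and its `ξ`-derivative is the indicator of `x ≤ ξ` off the null set `x =
ξ`, where the kernel has its kink. -/
theorem hasDerivAt_putFun {B : ℝ} {f : ℝ → ℝ} (hf : Integrable f (intervalMeasure B))
    {ξ : ℝ} (hξ : ξ ∈ Icc 0 B) : HasDerivAt (putFun B f) (∫ x in (0 : ℝ)..ξ, f x) ξ := by
  have key := (hasDerivAt_integral_of_dominated_loc_of_lip (μ := intervalMeasure B) (𝕜 := ℝ)
    (F := fun η x => putKernel η x * f x) (F' := (Iic ξ).indicator f) (x₀ := ξ) (s := univ)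
    (bound := fun x => |f x|) Filter.univ_mem
    (Filter.Eventually.of_forall fun η => (integrable_putKernel_mul hf η).aestronglyMeasurable)
    (integrable_putKernel_mul hf ξ) (hf.indicator measurableSet_Iic).aestronglyMeasurable
    (Filter.Eventually.of_forall fun x => ?_) hf.abs ?_).2
  · have : ∫ x in Icc 0 B, (Iic ξ).indicator f x = ∫ x in (0 : ℝ)..ξ, f x := by
      rw [setIntegral_indicator measurableSet_Iic, intervalIntegral.integral_of_le hξ.1,
        ← integral_Icc_eq_integral_Ioc]
      congr 2
      ext x
      simp only [mem_inter_iff, mem_Icc, mem_Iic]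
      exact ⟨fun h => ⟨h.1.1, h.2⟩, fun h => ⟨⟨h.1, h.2.trans hξ.2⟩, h.2⟩⟩
    rw [this] at key
    exact key
  · refine LipschitzOnWith.of_dist_le_mul fun η _ ζ _ => ?_
    rw [Real.dist_eq, Real.dist_eq, ← sub_mul, abs_mul, mul_comm]
    simp only [Real.coe_nnabs, abs_abs]
    exact mul_le_mul_of_nonneg_left (abs_putKernel_sub_le x η ζ) (abs_nonneg _)
  · have hne : ∀ᵐ x ∂(intervalMeasure B), x ≠ ξ :=
      ae_restrict_of_ae (by simp [ae_iff, measure_singleton])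
    filter_upwards [hne] with x hx
    rcases lt_or_gt_of_ne hx with h | h
    · rw [indicator_of_mem (mem_Iic.2 h.le)]
      have h1 : HasDerivAt (fun η => (η - x) * f x) (f x) ξ := by
        simpa using ((hasDerivAt_id ξ).sub_const x).mul_const (f x)
      refine h1.congr_of_eventuallyEq ?_
      filter_upwards [Ioi_mem_nhds h] with η hη
      simp only [putKernel, callKernel]
      rw [max_eq_left (by linarith [mem_Ioi.1 hη])]
    · rw [indicator_of_notMem (by simpa using h)]
      refine (hasDerivAt_const ξ (0 : ℝ)).congr_of_eventuallyEq ?_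
      filter_upwards [Iio_mem_nhds h] with η hη
      simp only [putKernel, callKernel]
      rw [max_eq_right (by linarith [mem_Iio.1 hη]), zero_mul]

theorem hasDerivAt_callFun {B : ℝ} {f : ℝ → ℝ} (hf : Integrable f (intervalMeasure B))
    {ξ : ℝ} (hξ : ξ ∈ Icc 0 B) :
    HasDerivAt (callFun B f) ((∫ x in (0 : ℝ)..ξ, f x) + -partialMoment B 0 f) ξ := by
  have h : callFun B f =
      fun η => putFun B f η + (partialMoment B 1 f - η * partialMoment B 0 f) := by
    funext η
    linarith [callFun_sub_putFun hf η]
  rw [h]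
  have h2 : HasDerivAt (fun η : ℝ => partialMoment B 1 f - η * partialMoment B 0 f)
      (-partialMoment B 0 f) ξ := by
    simpa using ((hasDerivAt_id ξ).mul_const (partialMoment B 0 f)).const_sub (partialMoment B 1 f)
  exact (hasDerivAt_putFun hf hξ).add h2

section Regularity

variable {B : ℝ} {f g : ℝ → ℝ} {c : ℝ}

theorem derivWithin_eqOn_of_hasDerivAt (hB : 0 < B) {F : ℝ → ℝ}
    (hg : ∀ ξ ∈ Icc 0 B, HasDerivAt g (F ξ) ξ) : EqOn (derivWithin g (Icc 0 B)) F (Icc 0 B) :=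
  fun ξ hξ => (hg ξ hξ).hasDerivWithinAt.derivWithin (uniqueDiffOn_Icc hB ξ hξ)

theorem AbsolutelyContinuousOnInterval.congr_eqOn {f g : ℝ → ℝ} {a b : ℝ}
    (hf : AbsolutelyContinuousOnInterval f a b) (h : EqOn g f (uIcc a b)) :
    AbsolutelyContinuousOnInterval g a b := by
  rw [absolutelyContinuousOnInterval_iff] at hf ⊢
  intro ε hε
  obtain ⟨δ, hδ, H⟩ := hf ε hε
  refine ⟨δ, hδ, fun E hE hlen => ?_⟩
  convert H E hE hlen using 1
  refine Finset.sum_congr rfl fun i hi => ?_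
  have := hE.1 i hi
  rw [h this.1, h this.2]

theorem continuousOn_primitive_add_const (hB : 0 < B) (hf : Integrable f (intervalMeasure B)) :
    ContinuousOn (fun ξ => (∫ x in (0 : ℝ)..ξ, f x) + c) (Icc 0 B) := by
  have h := intervalIntegral.continuousOn_primitive_interval (μ := volume) (f := f) (a := 0) (b := B)
    (by rw [uIcc_of_le hB.le]; exact hf)
  rw [uIcc_of_le hB.le] at h
  exact h.add continuousOn_const

/-- The constant `c` lets one statement serve both operators: it is `0` for the put and minus the
zeroth moment for the call. The almost everywhere derivative is Lebesgue's differentiation theorem.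
-/
theorem hasSecondDerivOn_of_hasDerivAt (hB : 0 < B) (hf : Integrable f (intervalMeasure B))
    (hg : ∀ ξ ∈ Icc 0 B, HasDerivAt g ((∫ x in (0 : ℝ)..ξ, f x) + c) ξ) :
    HasSecondDerivOn B g f := by
  have hd := derivWithin_eqOn_of_hasDerivAt hB hg
  have hi := intervalIntegrable_of_integrable hB.le hf
  refine ⟨?_, ?_, ?_⟩
  · rw [← zero_add (1 : WithTop ℕ∞), contDiffOn_succ_iff_derivWithin (uniqueDiffOn_Icc hB)]
    refine ⟨fun ξ hξ => (hg ξ hξ).hasDerivWithinAt.differentiableWithinAt, by simp, ?_⟩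
    rw [contDiffOn_zero]
    exact (continuousOn_primitive_add_const hB hf).congr hd
  · have h1 := hi.absolutelyContinuousOnInterval_intervalIntegral (c := 0) left_mem_uIcc
    have h2 : AbsolutelyContinuousOnInterval (fun _ : ℝ => c) 0 B :=
      (LipschitzWith.const c).lipschitzOnWith.absolutelyContinuousOnInterval
    refine (h1.add h2).congr_eqOn ?_
    rw [uIcc_of_le hB.le]
    exact hd
  · filter_upwards [ae_restrict_of_ae hi.ae_hasDerivAt_integral,
      ae_restrict_mem measurableSet_Icc] with ξ h hξ
    have h1 := (h (by rwa [uIcc_of_le hB.le]) 0 left_mem_uIcc).add_const c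
    exact h1.hasDerivWithinAt.congr hd (hd hξ)

theorem contDiffOn_two_of_hasDerivAt {h : ℝ → ℝ} (hB : 0 < B)
    (hg : ∀ ξ ∈ Icc 0 B, HasDerivAt g ((∫ x in (0 : ℝ)..ξ, f x) + c) ξ)
    (hh : ContinuousOn h (Icc 0 B)) (hfh : f =ᵐ[intervalMeasure B] h) :
    ContDiffOn ℝ 2 g (Icc 0 B) ∧
      ∀ ξ ∈ Icc 0 B, iteratedDerivWithin 2 g (Icc 0 B) ξ = h ξ := by
  have hd := derivWithin_eqOn_of_hasDerivAt hB hg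
  -- Extended continuously to the line, `h` has a primitive that is differentiable at every point,
  -- endpoints included.
  set k := IccExtend hB.le ((Icc 0 B).domRestrict h) with hk
  have hkc : Continuous k := (continuousOn_iff_continuous_domRestrict.1 hh).Icc_extend'
  have hkh : ∀ x ∈ Icc 0 B, k x = h x := fun x hx => by
    rw [hk, IccExtend_of_mem _ _ hx, domRestrict_apply]
  have hfk : f =ᵐ[intervalMeasure B] k := by
    filter_upwards [hfh, ae_restrict_mem measurableSet_Icc] with x h1 h2
    rw [h1, hkh x h2]
  have hint : EqOn (derivWithin g (Icc 0 B)) (fun ξ => (∫ x in (0 : ℝ)..ξ, k x) + c)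
      (Icc 0 B) := by
    intro ξ hξ
    rw [hd hξ]
    simp only [add_left_inj]
    rw [intervalIntegral.integral_of_le hξ.1, intervalIntegral.integral_of_le hξ.1]
    refine integral_congr_ae (ae_restrict_of_ae_restrict_of_subset ?_ hfk)
    exact fun x hx => ⟨hx.1.le, hx.2.trans hξ.2⟩
  have hder : ∀ ξ ∈ Icc 0 B,
      HasDerivWithinAt (derivWithin g (Icc 0 B)) (h ξ) (Icc 0 B) ξ := by
    intro ξ hξ
    have := ((hkc.integral_hasStrictDerivAt 0 ξ).hasDerivAt.add_const c).hasDerivWithinAt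
      (s := Icc 0 B)
    rw [hkh ξ hξ] at this
    exact this.congr hint (hint hξ)
  have hdd : EqOn (derivWithin (derivWithin g (Icc 0 B)) (Icc 0 B)) h (Icc 0 B) :=
    fun ξ hξ => (hder ξ hξ).derivWithin (uniqueDiffOn_Icc hB ξ hξ)
  constructor
  · rw [show (2 : WithTop ℕ∞) = 1 + 1 by norm_num,
      contDiffOn_succ_iff_derivWithin (uniqueDiffOn_Icc hB)]
    refine ⟨fun ξ hξ => (hg ξ hξ).hasDerivWithinAt.differentiableWithinAt, by simp, ?_⟩
    rw [← zero_add (1 : WithTop ℕ∞), contDiffOn_succ_iff_derivWithin (uniqueDiffOn_Icc hB)]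
    refine ⟨fun ξ hξ => (hder ξ hξ).differentiableWithinAt, by simp, ?_⟩
    rw [contDiffOn_zero]
    exact hh.congr hdd
  · intro ξ hξ
    rw [iteratedDerivWithin_succ, ← hdd hξ]
    exact derivWithin_congr (fun x _ => by rw [iteratedDerivWithin_one]) (by rw [iteratedDerivWithin_one])

end Regularity

theorem hasSecondDerivOn_callFun {B : ℝ} (hB : 0 < B) (f : L2I B) :
    HasSecondDerivOn B (callFun B f) f :=
  hasSecondDerivOn_of_hasDerivAt hB (L2I.integrable f)
    fun _ hξ => hasDerivAt_callFun (L2I.integrable f) hξ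

theorem hasSecondDerivOn_putFun {B : ℝ} (hB : 0 < B) (f : L2I B) :
    HasSecondDerivOn B (putFun B f) f :=
  hasSecondDerivOn_of_hasDerivAt (c := 0) hB (L2I.integrable f)
    fun _ hξ => by simpa using hasDerivAt_putFun (L2I.integrable f) hξ

/-! ### The second derivative as inverse; injectivity -/

/-- The second derivative depends only on the almost everywhere class of the function. -/
theorem HasSecondDerivOn.ae_eq {B : ℝ} (hB : 0 < B) {g₁ g₂ v₁ v₂ : ℝ → ℝ}
    (h₁ : HasSecondDerivOn B g₁ v₁) (h₂ : HasSecondDerivOn B g₂ v₂)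
    (hg : g₁ =ᵐ[intervalMeasure B] g₂) : v₁ =ᵐ[intervalMeasure B] v₂ := by
  -- Continuity upgrades almost everywhere equality to equality on the whole interval, so the first
  -- derivatives agree as well.
  have he : EqOn g₁ g₂ (Icc 0 B) :=
    Measure.eqOn_Icc_of_ae_eq volume hB.ne hg h₁.1.continuousOn h₂.1.continuousOn
  have hd : EqOn (derivWithin g₁ (Icc 0 B)) (derivWithin g₂ (Icc 0 B)) (Icc 0 B) :=
    fun x hx => derivWithin_congr he (he hx)
  filter_upwards [h₁.2.2, h₂.2.2, ae_restrict_mem measurableSet_Icc] with x h1 h2 hx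
  exact (uniqueDiffOn_Icc hB x hx).eq_deriv _ (h1.congr (fun y hy => (hd hy).symm) (hd hx).symm) h2

/-- If `u = γ f`, then `v` and `f` are both second derivatives of representatives of `u`, so `v =
f`. -/
theorem callOp_eq_of_hasSecondDerivOn {B : ℝ} (hB : 0 < B) {u v : L2I B} {g : ℝ → ℝ}
    (hu : u ∈ range (callOp B)) (hug : u =ᵐ[intervalMeasure B] g) (hg : HasSecondDerivOn B g v) :
    callOp B v = u := by
  obtain ⟨f, rfl⟩ := hu
  congr 1
  exact Lp.ext (hg.ae_eq hB (hasSecondDerivOn_callFun hB f) (hug.symm.trans (callOp_coeFn B f)))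

theorem putOp_eq_of_hasSecondDerivOn {B : ℝ} (hB : 0 < B) {u v : L2I B} {g : ℝ → ℝ}
    (hu : u ∈ range (putOp B)) (hug : u =ᵐ[intervalMeasure B] g) (hg : HasSecondDerivOn B g v) :
    putOp B v = u := by
  obtain ⟨f, rfl⟩ := hu
  congr 1
  exact Lp.ext (hg.ae_eq hB (hasSecondDerivOn_putFun hB f) (hug.symm.trans (putOp_coeFn B f)))

theorem callOp_injective {B : ℝ} (hB : 0 < B) : Function.Injective (callOp B) := fun f g h =>
  Lp.ext ((hasSecondDerivOn_callFun hB f).ae_eq hB (hasSecondDerivOn_callFun hB g)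
    ((callOp_coeFn B f).symm.trans (h ▸ callOp_coeFn B g)))

theorem putOp_injective {B : ℝ} (hB : 0 < B) : Function.Injective (putOp B) := fun f g h =>
  Lp.ext ((hasSecondDerivOn_putFun hB f).ae_eq hB (hasSecondDerivOn_putFun hB g)
    ((putOp_coeFn B f).symm.trans (h ▸ putOp_coeFn B g)))

/-! ### Adjointness and dense ranges -/

/-- Fubini, since the two kernels are transposes of each other; the integrand is a bounded kernel
times a product of integrable functions. -/
theorem inner_putOp_left (B : ℝ) (f g : L2I B) :
    inner ℝ (putOp B f) g = inner ℝ f (callOp B g) := by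
  have hprod : Integrable (Function.uncurry fun ξ x => putKernel ξ x * f x * g ξ)
      ((intervalMeasure B).prod (intervalMeasure B)) := by
    have h := (L2I.integrable g).mul_prod (L2I.integrable f)
    obtain ⟨C, hC⟩ := (isCompact_Icc.prod isCompact_Icc :
      IsCompact (Icc (0 : ℝ) B ×ˢ Icc (0 : ℝ) B)).exists_bound_of_continuousOn
        continuous_putKernel.continuousOn
    have h2 := h.bdd_mul (c := C) (f := Function.uncurry putKernel)
      continuous_putKernel.aestronglyMeasurable (by
        rw [Measure.prod_restrict]
        filter_upwards [ae_restrict_mem (measurableSet_Icc.prod measurableSet_Icc)] with z hz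
        exact hC z hz)
    refine h2.congr (Filter.Eventually.of_forall fun z => ?_)
    simp only [Function.uncurry]
    ring
  calc inner ℝ (putOp B f) g
      = ∫ ξ in Icc 0 B, ∫ x in Icc 0 B, putKernel ξ x * f x * g ξ := by
        rw [L2.inner_def]
        refine integral_congr_ae ?_
        filter_upwards [putOp_coeFn B f] with ξ hξ
        rw [hξ, integral_mul_const, RCLike.inner_apply, conj_trivial, mul_comm]
        rfl
    _ = ∫ x in Icc 0 B, ∫ ξ in Icc 0 B, putKernel ξ x * f x * g ξ :=
        integral_integral_swap hprod
    _ = inner ℝ f (callOp B g) := by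
        rw [L2.inner_def]
        refine integral_congr_ae ?_
        filter_upwards [callOp_coeFn B g] with x hx
        rw [hx, RCLike.inner_apply, conj_trivial, callFun, kernelFun, ← integral_mul_const]
        refine integral_congr_ae (Filter.Eventually.of_forall fun ξ => ?_)
        simp only [putKernel]
        ring

theorem putOp_eq_adjoint (B : ℝ) : putOp B = ContinuousLinearMap.adjoint (callOp B) :=
  (ContinuousLinearMap.eq_adjoint_iff _ _).2 (inner_putOp_left B)

theorem inner_callOp_left (B : ℝ) (f g : L2I B) :
    inner ℝ (callOp B f) g = inner ℝ f (putOp B g) := by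
  rw [real_inner_comm, ← inner_putOp_left, real_inner_comm]

/-- An operator whose formal adjoint is injective has dense range. -/
theorem denseRange_of_inner_eq_of_injective {E : Type*} [NormedAddCommGroup E]
    [InnerProductSpace ℝ E] [CompleteSpace E] {S T : E →L[ℝ] E}
    (h : ∀ x y, inner ℝ (S x) y = inner ℝ x (T y)) (hT : Function.Injective T) :
    DenseRange S := by
  have hbot : (LinearMap.range (S : E →ₗ[ℝ] E))ᗮ = ⊥ := by
    rw [Submodule.eq_bot_iff]
    intro y hy
    refine hT ?_
    rw [map_zero]
    refine ext_inner_left ℝ fun x => ?_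
    rw [← h, inner_zero_right]
    exact hy (S x) ⟨x, rfl⟩
  have := (Submodule.topologicalClosure_eq_top_iff).2 hbot
  rw [← Submodule.dense_iff_topologicalClosure_eq_top] at this
  exact this

theorem denseRange_callOp {B : ℝ} (hB : 0 < B) : DenseRange (callOp B) :=
  denseRange_of_inner_eq_of_injective (inner_callOp_left B) (putOp_injective hB)

theorem denseRange_putOp {B : ℝ} (hB : 0 < B) : DenseRange (putOp B) :=
  denseRange_of_inner_eq_of_injective (inner_putOp_left B) (callOp_injective hB)

/-! ### Compactness of `γ` -/

theorem abs_callKernel_sub_le (x ξ η : ℝ) : |callKernel ξ x - callKernel η x| ≤ |ξ - η| := by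
  unfold callKernel
  have := abs_max_sub_max_le_abs (x - ξ) (x - η) 0
  rwa [sub_sub_sub_cancel_left, abs_sub_comm η ξ] at this

/-- This Lipschitz bound controls the error of sampling `γ f` on a grid by the mesh times the `L¹`
norm of `f`. -/
theorem abs_callFun_sub_le {B : ℝ} {f : ℝ → ℝ} (hf : Integrable f (intervalMeasure B))
    (ξ η : ℝ) : |callFun B f ξ - callFun B f η| ≤ |ξ - η| * ∫ x in Icc 0 B, |f x| := by
  unfold callFun kernelFun
  rw [← integral_sub (integrable_callKernel_mul hf ξ) (integrable_callKernel_mul hf η),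
    ← integral_const_mul]
  refine (Real.norm_eq_abs _).symm.trans_le (norm_integral_le_of_norm_le (hf.abs.const_mul _)
    (Filter.Eventually.of_forall fun x => ?_))
  rw [← sub_mul, Real.norm_eq_abs, abs_mul]
  exact mul_le_mul_of_nonneg_right (abs_callKernel_sub_le x ξ η) (abs_nonneg _)

theorem memLp_callKernel (B ξ : ℝ) : MemLp (callKernel ξ) 2 (intervalMeasure B) := by
  have hc : Continuous (callKernel ξ) := by unfold callKernel; fun_prop
  obtain ⟨C, hC⟩ := isCompact_Icc.exists_bound_of_continuousOn (s := Icc 0 B) hc.continuousOn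
  exact MemLp.of_bound hc.aestronglyMeasurable C
    ((ae_restrict_mem measurableSet_Icc).mono fun x hx => hC x hx)

/-- Evaluation of `γ f` at a point is thus a bounded functional of `f`, which makes the sampled
operator bounded and of finite rank. -/
theorem inner_toLp_callKernel (B ξ : ℝ) (f : L2I B) :
    inner ℝ ((memLp_callKernel B ξ).toLp _) f = callFun B f ξ := by
  rw [L2.inner_def]
  refine integral_congr_ae ?_
  filter_upwards [(memLp_callKernel B ξ).coeFn_toLp] with x hx
  rw [hx, RCLike.inner_apply, conj_trivial, mul_comm]

/-- The interpolation of the call operator by step functions on the cells of the uniform partition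
of `[0, B]` into `n` cells. -/
noncomputable def stepCallOp (B : ℝ) (n : ℕ) : L2I B →L[ℝ] L2I B :=
  ∑ i ∈ Finset.range n, (innerSL ℝ ((memLp_callKernel B (B / n * i)).toLp _)).smulRight
    (indicatorConstLp 2 (μ := intervalMeasure B)
      (measurableSet_Ico (a := B / n * i) (b := B / n * (i + 1))) (measure_ne_top _ _) (1 : ℝ))

theorem isCompactOperator_stepCallOp (B : ℝ) (n : ℕ) : IsCompactOperator (stepCallOp B n) := by
  have : stepCallOp B n ∈ compactOperator (RingHom.id ℝ) (L2I B) (L2I B) := by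
    refine Submodule.sum_mem _ fun i _ => ?_
    -- Each summand factors through `ℝ`.
    exact (isCompactOperator_of_locallyCompactSpace_dom
      (innerSL ℝ ((memLp_callKernel B (B / n * i)).toLp _))).clm_comp
      ((ContinuousLinearMap.id ℝ ℝ).smulRight (indicatorConstLp 2 (μ := intervalMeasure B)
      (measurableSet_Ico (a := B / n * i) (b := B / n * (i + 1))) (measure_ne_top _ _) (1 : ℝ)))
  exact this

theorem stepCallOp_coeFn (B : ℝ) (n : ℕ) (f : L2I B) :
    stepCallOp B n f =ᵐ[intervalMeasure B] fun ξ => ∑ i ∈ Finset.range n,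
      callFun B f (B / n * i) * (Ico (B / n * i) (B / n * (i + 1))).indicator (fun _ => (1 : ℝ)) ξ := by
  have h1 : stepCallOp B n f = ∑ i ∈ Finset.range n, callFun B f (B / n * i) •
      (indicatorConstLp 2 (μ := intervalMeasure B)
      (measurableSet_Ico (a := B / n * i) (b := B / n * (i + 1))) (measure_ne_top _ _) (1 : ℝ)) := by
    rw [stepCallOp, sum_apply]
    refine Finset.sum_congr rfl fun i _ => ?_
    rw [ContinuousLinearMap.smulRight_apply, innerSL_apply_apply, inner_toLp_callKernel]
  rw [h1]
  refine (Lp.coeFn_fun_finsetSum _ _).trans ?_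
  have h2 : ∀ᵐ ξ ∂(intervalMeasure B), ∀ i : ℕ, (callFun B f (B / n * i) •
      (indicatorConstLp 2 (μ := intervalMeasure B)
      (measurableSet_Ico (a := B / n * i) (b := B / n * (i + 1))) (measure_ne_top _ _) (1 : ℝ)) :
        L2I B) ξ =
      callFun B f (B / n * i) * (Ico (B / n * i) (B / n * (i + 1))).indicator (fun _ => (1 : ℝ)) ξ := by
    rw [ae_all_iff]
    intro i
    filter_upwards [Lp.coeFn_smul (callFun B f (B / n * i)) (indicatorConstLp 2
      (μ := intervalMeasure B) (measurableSet_Ico (a := B / n * i) (b := B / n * (i + 1)))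
      (measure_ne_top _ _) (1 : ℝ)), indicatorConstLp_coeFn (p := 2) (μ := intervalMeasure B)
      (hs := measurableSet_Ico (a := B / n * i) (b := B / n * (i + 1)))
      (hμs := measure_ne_top _ _) (c := (1 : ℝ))] with ξ h3 h4
    rw [h3, Pi.smul_apply, smul_eq_mul, h4]
  filter_upwards [h2] with ξ hξ
  exact Finset.sum_congr rfl fun i _ => hξ i

theorem abs_callOp_sub_stepCallOp_le {B : ℝ} (hB : 0 < B) {n : ℕ} (hn : 0 < n) (f : L2I B) :
    ∀ᵐ ξ ∂(intervalMeasure B),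
      ‖(callOp B f - stepCallOp B n f) ξ‖ ≤ B / n * ∫ x in Icc 0 B, |f x| := by
  -- The half-open cells miss the right endpoint.
  have hne : ∀ᵐ ξ ∂(intervalMeasure B), ξ ≠ B :=
    ae_restrict_of_ae (by simp [ae_iff, measure_singleton])
  have hδ : 0 < B / n := by positivity
  filter_upwards [Lp.coeFn_sub (callOp B f) (stepCallOp B n f), callOp_coeFn B f,
    stepCallOp_coeFn B n f, ae_restrict_mem measurableSet_Icc, hne] with ξ h1 h2 h3 hξ hξB
  rw [h1, Pi.sub_apply, h2, h3]
  set j := ⌊ξ / (B / n)⌋₊ with hj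
  have hq : 0 ≤ ξ / (B / n) := div_nonneg hξ.1 hδ.le
  have hjle : B / n * j ≤ ξ := by
    have := Nat.floor_le hq
    rwa [← hj, le_div_iff₀ hδ, mul_comm] at this
  have hjlt : ξ < B / n * (j + 1) := by
    have := Nat.lt_floor_add_one (ξ / (B / n))
    rwa [← hj, div_lt_iff₀ hδ, mul_comm] at this
  have hjn : j ∈ Finset.range n := by
    rw [Finset.mem_range, hj, Nat.floor_lt hq, div_lt_iff₀ hδ]
    have : (n : ℝ) * (B / n) = B := by field_simp
    rw [this]
    exact lt_of_le_of_ne hξ.2 hξB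
  rw [Finset.sum_eq_single_of_mem j hjn, indicator_of_mem (show ξ ∈ Ico _ _ from ⟨hjle, hjlt⟩),
    mul_one]
  · refine (abs_callFun_sub_le (L2I.integrable f) _ _).trans ?_
    refine mul_le_mul_of_nonneg_right ?_ (integral_nonneg fun _ => abs_nonneg _)
    rw [abs_of_nonneg (by linarith)]
    linarith
  · intro i _ hij
    rw [indicator_of_notMem, mul_zero]
    rintro ⟨hi1, hi2⟩
    refine hij ?_
    have a1 : (i : ℝ) < j + 1 := lt_of_mul_lt_mul_left (hi1.trans_lt hjlt) hδ.le
    have a2 : (j : ℝ) < i + 1 := lt_of_mul_lt_mul_left (hjle.trans_lt hi2) hδ.le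
    norm_cast at a1 a2
    omega

theorem exists_integral_abs_le_norm (B : ℝ) :
    ∃ M : ℝ, 0 ≤ M ∧ ∀ f : L2I B, ∫ x in Icc 0 B, |f x| ≤ M * ‖f‖ := by
  -- Cauchy-Schwarz against the constant function `1`.
  refine ⟨‖indicatorConstLp 2 (μ := intervalMeasure B) MeasurableSet.univ (measure_ne_top _ _)
    (1 : ℝ)‖, norm_nonneg _, fun f => ?_⟩
  have h : ∫ x in Icc 0 B, |f x| = inner ℝ (indicatorConstLp 2 (μ := intervalMeasure B)
      MeasurableSet.univ (measure_ne_top _ _) (1 : ℝ)) |f| := by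
    rw [L2.inner_indicatorConstLp_one, setIntegral_univ]
    exact integral_congr_ae ((Lp.coeFn_abs f).mono fun x hx => hx.symm)
  rw [h]
  refine (real_inner_le_norm _ _).trans ?_
  rw [norm_abs_eq_norm]

/-- Norm limit of finite-rank operators: the error is at most `C * (B / n * M)`, where `C` passes
from the sup bound to the `L²` norm and `M` from the `L²` to the `L¹` norm. -/
theorem isCompactOperator_callOp {B : ℝ} (hB : 0 < B) : IsCompactOperator (callOp B) := by
  obtain ⟨M, hM0, hM⟩ := exists_integral_abs_le_norm B
  set C : ℝ := (measureUnivNNReal (intervalMeasure B)) ^ (2 : ENNReal).toReal⁻¹ with hC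
  have hC0 : 0 ≤ C := by positivity
  refine isCompactOperator_of_tendsto (l := Filter.atTop) (F := fun n : ℕ => stepCallOp B n) ?_
    (Filter.Eventually.of_forall fun n => isCompactOperator_stepCallOp B n)
  rw [tendsto_iff_norm_sub_tendsto_zero]
  have hlim : Filter.Tendsto (fun n : ℕ => C * (B / n * M)) Filter.atTop (nhds 0) := by
    have := ((tendsto_const_div_atTop_nhds_zero_nat B).mul_const M).const_mul C
    simpa using this
  refine squeeze_zero' (Filter.Eventually.of_forall fun n => norm_nonneg _) ?_ hlim
  filter_upwards [Filter.eventually_gt_atTop 0] with n hn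
  rw [norm_sub_rev]
  refine ContinuousLinearMap.opNorm_le_bound _ (by positivity) fun f => ?_
  refine (Lp.norm_le_of_ae_bound (by positivity)
    (abs_callOp_sub_stepCallOp_le hB hn f)).trans ?_
  rw [← hC, mul_assoc, mul_assoc]
  gcongr
  exact hM f

/-! ### Simplicity of the eigenvalues -/

theorem putFun_congr_ae {B : ℝ} {f g : ℝ → ℝ} (h : f =ᵐ[intervalMeasure B] g) :
    putFun B f = putFun B g := by
  funext ξ
  refine integral_congr_ae ?_
  filter_upwards [h] with x hx
  rw [hx]

theorem putFun_const_mul (B c : ℝ) (f : ℝ → ℝ) (ξ : ℝ) :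
    putFun B (fun x => c * f x) ξ = c * putFun B f ξ := by
  unfold putFun kernelFun
  rw [← integral_const_mul]
  congr 1
  funext x
  ring

theorem putKernel_eq_zero {ξ x : ℝ} (h : ξ ≤ x) : putKernel ξ x = 0 :=
  max_eq_right (by linarith)

theorem putKernel_nonneg (ξ x : ℝ) : 0 ≤ putKernel ξ x := le_max_right _ _

theorem putFun_nonneg {B ξ : ℝ} {g : ℝ → ℝ} (hg : ∀ x ∈ Icc 0 B, x < ξ → 0 ≤ g x) :
    0 ≤ putFun B g ξ := by
  refine setIntegral_nonneg measurableSet_Icc fun x hx => ?_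
  rcases lt_or_ge x ξ with h | h
  · exact mul_nonneg (putKernel_nonneg _ _) (hg x hx h)
  · rw [putKernel_eq_zero h, zero_mul]

/-- A solution of `w'''' = μ w` with `w 0 > 0` and `w' 0 = w'' 0 = w''' 0 = 0`, in integral form,
is positive. -/
theorem pos_of_eq_const_add_putFun {B μ b : ℝ} (hμ : 0 ≤ μ) (hb : 0 < b) {w : ℝ → ℝ}
    (hw : ContinuousOn w (Icc 0 B))
    (h : ∀ ξ ∈ Icc 0 B, w ξ = b + μ * putFun B (putFun B w) ξ) : ∀ ξ ∈ Icc 0 B, 0 < w ξ := by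
  by_contra! hne
  obtain ⟨η, hη, hη0⟩ := hne
  -- Let `t` be the first point with `w t ≤ 0`. The put integral at `t` sees only the past, where `w
  -- ≥ 0`, so the equation gives `w t ≥ b > 0`.
  have hcl : IsClosed (Icc 0 B ∩ w ⁻¹' Iic 0) :=
    hw.preimage_isClosed_of_isClosed isClosed_Icc isClosed_Iic
  obtain ⟨t, ⟨ht, ht0⟩, hmin⟩ := (isCompact_Icc.of_isClosed_subset hcl
    inter_subset_left).exists_isLeast ⟨η, hη, hη0⟩
  have hpos : ∀ x ∈ Icc 0 B, x < t → 0 ≤ w x := fun x hx hxt => by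
    by_contra! hlt
    exact absurd (hmin ⟨hx, hlt.le⟩) (not_le.2 hxt)
  have h2 : 0 ≤ putFun B (putFun B w) t := putFun_nonneg fun x hx hxt =>
    putFun_nonneg fun y hy hyx => hpos y hy (hyx.trans hxt)
  have h3 := h t ht
  have h4 : w t ≤ 0 := ht0
  have := mul_nonneg hμ h2
  linarith

/-- In the sup norm with weight `exp (-k x)`, the put operator has norm at most `B / k`, because `s
≤ exp (k s) / k`. -/
theorem abs_putFun_le {B k M : ℝ} (hB : 0 ≤ B) (hk : 0 < k) {g : ℝ → ℝ} (hM : 0 ≤ M)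
    (hg : ∀ x ∈ Icc 0 B, |g x| ≤ M * Real.exp (k * x)) (ξ : ℝ) :
    |putFun B g ξ| ≤ B / k * M * Real.exp (k * ξ) := by
  have h : ‖∫ x in Icc 0 B, putKernel ξ x * g x‖ ≤
      (M / k * Real.exp (k * ξ)) * volume.real (Icc 0 B) := by
    refine norm_setIntegral_le_of_norm_le_const (by simp) fun x hx => ?_
    rw [norm_mul, Real.norm_eq_abs, Real.norm_eq_abs, abs_of_nonneg (putKernel_nonneg _ _)]
    rcases le_total ξ x with h | h
    · rw [putKernel_eq_zero h, zero_mul]; positivity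
    · have h1 : putKernel ξ x ≤ Real.exp (k * (ξ - x)) / k := by
        rw [putKernel, callKernel, max_eq_left (by linarith), le_div_iff₀ hk]
        linarith [Real.add_one_le_exp (k * (ξ - x))]
      calc putKernel ξ x * |g x|
          ≤ Real.exp (k * (ξ - x)) / k * (M * Real.exp (k * x)) :=
            mul_le_mul h1 (hg x hx) (abs_nonneg _) (by positivity)
        _ = M / k * (Real.exp (k * (ξ - x)) * Real.exp (k * x)) := by ring
        _ = M / k * Real.exp (k * ξ) := by rw [← Real.exp_add]; congr 2; ring
  rw [Real.volume_real_Icc_of_le hB, sub_zero] at h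
  refine (Real.norm_eq_abs _).symm.trans_le (h.trans_eq ?_)
  ring

/-- A Volterra equation has no nontrivial continuous solution. -/
theorem eq_zero_of_eq_putFun {B μ : ℝ} (hB : 0 < B) (hμ : 0 ≤ μ) {w : ℝ → ℝ}
    (hw : ContinuousOn w (Icc 0 B))
    (h : ∀ ξ ∈ Icc 0 B, w ξ = μ * putFun B (putFun B w) ξ) : ∀ ξ ∈ Icc 0 B, w ξ = 0 := by
  -- With this weight `B / k = 1 / (2 μ + 1)`, so the right-hand side contracts the weighted norm by
  -- `μ / (2 μ + 1)² ≤ 1 / 2`.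
  set k : ℝ := B * (2 * μ + 1) with hk
  have hk0 : 0 < k := by positivity
  obtain ⟨t, ht, hmax⟩ := isCompact_Icc.exists_isMaxOn (nonempty_Icc.2 hB.le)
    (f := fun ξ => |w ξ| * Real.exp (-(k * ξ)))
    (hw.abs.mul (by fun_prop))
  set M := |w t| * Real.exp (-(k * t)) with hM
  have hM0 : 0 ≤ M := by positivity
  have hle : ∀ x ∈ Icc 0 B, |w x| ≤ M * Real.exp (k * x) := fun x hx => by
    have : |w x| * Real.exp (-(k * x)) ≤ M := hmax hx
    rwa [Real.exp_neg, ← div_eq_mul_inv, div_le_iff₀ (Real.exp_pos _)] at this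
  have h1 := abs_putFun_le hB.le hk0 hM0 hle
  have h2 := abs_putFun_le hB.le hk0 (M := B / k * M) (by positivity) (fun x _ => h1 x) t
  have h3 : M * Real.exp (k * t) = |w t| := by
    rw [hM, mul_assoc, ← Real.exp_add]; simp
  have h4 : |w t| ≤ μ * (B / k * (B / k * M) * Real.exp (k * t)) := by
    rw [h t ht, abs_mul, abs_of_nonneg hμ]
    exact mul_le_mul_of_nonneg_left h2 hμ
  have hBk : B / k = 1 / (2 * μ + 1) := by rw [hk]; field_simp
  have h5 : M ≤ μ * (1 / (2 * μ + 1)) ^ 2 * M := by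
    rw [← h3, hBk] at h4
    refine le_of_mul_le_mul_right (h4.trans_eq ?_) (Real.exp_pos (k * t))
    ring
  have h6 : μ * (1 / (2 * μ + 1)) ^ 2 ≤ 1 / 2 := by
    rw [one_div_pow, mul_one_div, div_le_div_iff₀ (by positivity) (by norm_num)]
    nlinarith
  have h7 : M = 0 := by nlinarith
  intro ξ hξ
  have := hle ξ hξ
  rw [h7, zero_mul] at this
  exact abs_nonpos_iff.1 this

theorem callFun_right_endpoint (B : ℝ) (f : ℝ → ℝ) : callFun B f B = 0 := by
  refine (setIntegral_congr_fun measurableSet_Icc fun x hx => ?_).trans (integral_zero _ _)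
  rw [callKernel, max_eq_right (by linarith [hx.2]), zero_mul]

/-- A linear functional that is injective on an eigenspace bounds its dimension by one; the zeroth
moment is such a functional. -/
theorem eq_zero_of_eigen_of_partialMoment_eq_zero {B c : ℝ} (hB : 0 < B) (hc : 0 < c)
    {f : L2I B} (hf : putOp B (callOp B f) = c • f) (h0 : partialMoment B 0 f = 0) : f = 0 := by
  have hwc : ContinuousOn (callFun B f) (Icc 0 B) := (hasSecondDerivOn_callFun hB f).1.continuousOn
  have hfeq : f =ᵐ[intervalMeasure B] fun x => c⁻¹ * putFun B (callFun B f) x := by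
    have h1 := putOp_coeFn B (callOp B f)
    rw [hf, putFun_congr_ae (callOp_coeFn B f)] at h1
    filter_upwards [h1, Lp.coeFn_smul c f] with x h2 h3
    rw [h3, Pi.smul_apply, smul_eq_mul] at h2
    rw [← h2, inv_mul_cancel_left₀ hc.ne']
  set b := partialMoment B 1 f with hb
  -- Parity with vanishing slope, where `f` inside `γ* f` is replaced by `c⁻¹ γ*γ f`.
  have hw : ∀ ξ ∈ Icc 0 B,
      callFun B f ξ = b + c⁻¹ * putFun B (putFun B (callFun B f)) ξ := fun ξ _ => by
    have h1 := callFun_sub_putFun (L2I.integrable f) ξ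
    rw [h0, mul_zero, sub_zero, putFun_congr_ae hfeq, putFun_const_mul] at h1
    linarith
  have hBmem : B ∈ Icc 0 B := right_mem_Icc.2 hB.le
  have hci : 0 ≤ c⁻¹ := (inv_pos.2 hc).le
  have hb0 : b = 0 := by
    rcases lt_trichotomy b 0 with h | h | h
    -- A negative constant is reduced to a positive one by passing to `-w`.
    · have := pos_of_eq_const_add_putFun (w := fun x => -1 * callFun B f x) hci (neg_pos.2 h)
        (continuousOn_const.mul hwc) (fun ξ hξ => by
          have h2 : putFun B (fun x => -1 * callFun B f x) =
              fun x => -1 * putFun B (callFun B f) x := funext fun x => putFun_const_mul _ _ _ _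
          rw [h2, putFun_const_mul, hw ξ hξ]
          ring) B hBmem
      rw [callFun_right_endpoint] at this
      simp at this
    · exact h
    · have := pos_of_eq_const_add_putFun hci h hwc hw B hBmem
      rw [callFun_right_endpoint] at this
      exact absurd this (lt_irrefl _)
  have hz := eq_zero_of_eq_putFun hB hci hwc (fun ξ hξ => by rw [hw ξ hξ, hb0, zero_add])
  refine callOp_injective hB ?_
  rw [map_zero]
  refine Lp.ext ?_
  filter_upwards [callOp_coeFn B f, Lp.coeFn_zero ℝ 2 (intervalMeasure B),
    ae_restrict_mem measurableSet_Icc] with x h1 h2 hx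
  rw [h1, h2, hz x hx]
  rfl

theorem partialMoment_zero_sub_smul {B : ℝ} (a : ℝ) (f g : L2I B) :
    partialMoment B 0 (g - a • f : L2I B) = partialMoment B 0 g - a * partialMoment B 0 f := by
  simp only [partialMoment, pow_zero, one_mul]
  rw [← integral_const_mul, ← integral_sub (L2I.integrable g) ((L2I.integrable f).const_mul a)]
  refine integral_congr_ae ?_
  filter_upwards [Lp.coeFn_sub g (a • f), Lp.coeFn_smul a f] with x h1 h2
  rw [h1, Pi.sub_apply, h2, Pi.smul_apply, smul_eq_mul]

/-- The eigenspaces of `γ*γ` are at most one-dimensional. -/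
theorem exists_smul_eq_of_eigen_left {B c : ℝ} (hB : 0 < B) (hc : 0 < c) {f g : L2I B}
    (hf0 : f ≠ 0) (hf : putOp B (callOp B f) = c • f) (hg : putOp B (callOp B g) = c • g) :
    ∃ a : ℝ, a • f = g := by
  have hm : partialMoment B 0 f ≠ 0 := fun h =>
    hf0 (eq_zero_of_eigen_of_partialMoment_eq_zero hB hc hf h)
  -- The scalar that makes the zeroth moment of `g - a • f` vanish.
  refine ⟨partialMoment B 0 g / partialMoment B 0 f, (sub_eq_zero.1 ?_).symm⟩
  refine eq_zero_of_eigen_of_partialMoment_eq_zero hB hc ?_ ?_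
  · rw [map_sub, map_sub, map_smul, map_smul, hf, hg, smul_sub, smul_comm]
  · rw [partialMoment_zero_sub_smul, div_mul_cancel₀ _ hm, sub_self]

/-- The eigenspaces of `γγ*` are at most one-dimensional. -/
theorem exists_smul_eq_of_eigen_right {B c : ℝ} (hB : 0 < B) (hc : 0 < c) {f g : L2I B}
    (hf0 : f ≠ 0) (hf : callOp B (putOp B f) = c • f) (hg : callOp B (putOp B g) = c • g) :
    ∃ a : ℝ, a • f = g := by
  have hinj := putOp_injective hB
  -- `γ*` maps eigenvectors of `γγ*` injectively to eigenvectors of `γ*γ` for the same eigenvalue.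
  obtain ⟨a, ha⟩ := exists_smul_eq_of_eigen_left hB hc (f := putOp B f) (g := putOp B g)
    (fun h => hf0 (hinj (h.trans (map_zero _).symm))) (by rw [hf, map_smul]) (by rw [hg, map_smul])
  exact ⟨a, hinj (by rw [map_smul, ha])⟩

/-! ### Arbitrary spectral systems and their expansions -/

theorem dense_span_of_range_subset {E : Type*} [NormedAddCommGroup E] [NormedSpace ℝ E]
    {T : E → E} (hT : DenseRange T) {v : ℕ → E}
    (h : ∀ f, T f ∈ (Submodule.span ℝ (range v)).topologicalClosure) :
    ⊤ ≤ (Submodule.span ℝ (range v)).topologicalClosure := fun f _ =>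
  closure_minimal (range_subset_iff.2 h) (Submodule.isClosed_topologicalClosure _) (hT f)

namespace IsSpectralSystem

variable {B : ℝ} {lam : ℕ → ℝ} {φ ψ : ℕ → L2I B}

/-- Completeness is assumed only on the range of `γ*γ`, but that range is dense. -/
theorem top_le_span_left (hB : 0 < B) (h : IsSpectralSystem B lam φ ψ) :
    ⊤ ≤ (Submodule.span ℝ (range φ)).topologicalClosure :=
  dense_span_of_range_subset
    ((denseRange_putOp hB).comp (denseRange_callOp hB) (putOp B).continuous) h.complete_left

theorem top_le_span_right (hB : 0 < B) (h : IsSpectralSystem B lam φ ψ) :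
    ⊤ ≤ (Submodule.span ℝ (range ψ)).topologicalClosure :=
  dense_span_of_range_subset
    ((denseRange_callOp hB).comp (denseRange_putOp hB) (callOp B).continuous) h.complete_right

/-- `γ φ_k` is an eigenvector of `γγ*` for `λ_k²`, so simplicity puts it on the line of `ψ_k`; its
norm is `λ_k`, and the sign condition fixes the factor. -/
theorem callOp_eq (hB : 0 < B) (h : IsSpectralSystem B lam φ ψ) {k : ℕ}
    (hk : 0 ≤ inner ℝ (callOp B (φ k)) (ψ k)) : callOp B (φ k) = lam k • ψ k := by
  have hpos := h.pos k
  obtain ⟨a, ha⟩ := exists_smul_eq_of_eigen_right hB (pow_pos hpos 2)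
    (h.orthonormal_right.ne_zero k) (h.eigen_right k) (g := callOp B (φ k))
    (by rw [h.eigen_left k, map_smul])
  have hψ : inner ℝ (ψ k) (ψ k) = (1 : ℝ) := by
    rw [real_inner_self_eq_norm_sq, h.orthonormal_right.1 k, one_pow]
  have hφ : inner ℝ (φ k) (φ k) = (1 : ℝ) := by
    rw [real_inner_self_eq_norm_sq, h.orthonormal_left.1 k, one_pow]
  have ha0 : 0 ≤ a := by
    rwa [← ha, real_inner_smul_left, hψ, mul_one] at hk
  have hsq : a ^ 2 = lam k ^ 2 := by
    have h1 : inner ℝ (callOp B (φ k)) (callOp B (φ k)) = lam k ^ 2 := by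
      rw [inner_callOp_left, h.eigen_left k, real_inner_smul_right, hφ, mul_one]
    rw [← ha, real_inner_smul_left, real_inner_smul_right, hψ] at h1
    linarith
  rw [← ha, (pow_left_inj₀ ha0 hpos.le two_ne_zero).1 hsq]

theorem putOp_eq (hB : 0 < B) (h : IsSpectralSystem B lam φ ψ) {k : ℕ}
    (hk : 0 ≤ inner ℝ (callOp B (φ k)) (ψ k)) : putOp B (ψ k) = lam k • φ k := by
  have h1 := h.eigen_left k
  rw [h.callOp_eq hB hk, map_smul, pow_two, mul_smul] at h1
  exact smul_right_injective _ (h.pos k).ne' h1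

end IsSpectralSystem

theorem hasSum_inner_smul {E : Type*} [NormedAddCommGroup E] [InnerProductSpace ℝ E]
    [CompleteSpace E] {v : ℕ → E} (hv : Orthonormal ℝ v)
    (hsp : ⊤ ≤ (Submodule.span ℝ (range v)).topologicalClosure) (f : E) :
    HasSum (fun k => inner ℝ f (v k) • v k) f := by
  have h := (HilbertBasis.mk hv hsp).hasSum_repr f
  simp only [HilbertBasis.repr_apply_apply, HilbertBasis.coe_mk] at h
  simpa only [real_inner_comm] using h

theorem hasSum_map_inner_smul {E : Type*} [NormedAddCommGroup E] [InnerProductSpace ℝ E]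
    [CompleteSpace E] {v w : ℕ → E} {lam : ℕ → ℝ} (hv : Orthonormal ℝ v)
    (hsp : ⊤ ≤ (Submodule.span ℝ (range v)).topologicalClosure) {T : E →L[ℝ] E}
    (hT : ∀ k, T (v k) = lam k • w k) (f : E) :
    HasSum (fun k => (lam k * inner ℝ f (v k)) • w k) (T f) := by
  have h := (hasSum_inner_smul hv hsp f).mapL T
  simp only [map_smul, hT, smul_smul] at h
  simpa only [mul_comm] using h

/-! ### Existence of a singular value decomposition -/

/-- An infinite set of reals that is finite above every positive level, and consists of positive
numbers, is the range of a strictly decreasing sequence. -/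
theorem exists_strictAnti_range_eq {S : Set ℝ} (hinf : S.Infinite) (hpos : ∀ s ∈ S, 0 < s)
    (hfin : ∀ ε > 0, (S ∩ Ici ε).Finite) : ∃ u : ℕ → ℝ, StrictAnti u ∧ range u = S := by
  classical
  -- In the reversed order initial segments are finite, so the order is locally finite with a least
  -- and no greatest element, hence isomorphic to `ℕ`.
  have hfin' : ∀ a : Sᵒᵈ, (Iic a).Finite := fun a => by
    refine Finite.of_finite_image (f := fun x : Sᵒᵈ => ((OrderDual.ofDual x : S) : ℝ))
      ((hfin _ (hpos _ (OrderDual.ofDual a).2)).subset ?_)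
      (fun x _ y _ hxy => OrderDual.ofDual.injective (Subtype.ext hxy))
    rintro _ ⟨x, hx, rfl⟩
    exact ⟨(OrderDual.ofDual x).2, hx⟩
  have : Infinite Sᵒᵈ := hinf.to_subtype
  let : LocallyFiniteOrder Sᵒᵈ := LocallyFiniteOrder.ofFiniteIcc fun a b =>
    (hfin' b).subset Icc_subset_Iic_self
  let : SuccOrder Sᵒᵈ := LinearLocallyFiniteOrder.succOrder _
  let : PredOrder Sᵒᵈ := LinearLocallyFiniteOrder.predOrder _
  obtain ⟨a⟩ : Nonempty Sᵒᵈ := inferInstance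
  obtain ⟨m, hm⟩ := (hfin' a).exists_minimal ⟨a, mem_Iic.2 le_rfl⟩
  let : OrderBot Sᵒᵈ :=
    { bot := m
      bot_le := fun x => by
        by_contra! hx
        exact absurd (hm.2 (hx.le.trans hm.1) hx.le) (not_le.2 hx) }
  have : NoMaxOrder Sᵒᵈ := ⟨fun x => by
    by_contra! hx
    exact infinite_univ ((hfin' x).subset fun y _ => hx y)⟩
  let e : Sᵒᵈ ≃o ℕ := orderIsoNatOfLinearSuccPredArch
  refine ⟨fun n => (OrderDual.ofDual (e.symm n) : S), fun i j hij => ?_, ?_⟩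
  · exact e.symm.strictMono hij
  · ext x
    constructor
    · rintro ⟨n, rfl⟩
      exact (OrderDual.ofDual (e.symm n)).2
    · intro hx
      exact ⟨e (OrderDual.toDual ⟨x, hx⟩), by simp⟩

section Spectral

variable {E : Type*} [NormedAddCommGroup E] [InnerProductSpace ℝ E]

theorem inner_eq_zero_of_eigen {T : E →L[ℝ] E} (hT : ∀ x y, inner ℝ (T x) y = inner ℝ x (T y))
    {a b : ℝ} (hab : a ≠ b) {x y : E} (hx : T x = a • x) (hy : T y = b • y) :
    inner ℝ x y = (0 : ℝ) := by
  have h := hT x y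
  rw [hx, hy, real_inner_smul_left, real_inner_smul_right] at h
  have : (a - b) * inner ℝ x y = 0 := by linarith
  exact (mul_eq_zero.1 this).resolve_left (sub_ne_zero.2 hab)

/-- The eigenvalues of a compact symmetric operator accumulate only at zero. -/
theorem finite_eigenvalues_ge {T : E →L[ℝ] E}
    (hT : ∀ x y, inner ℝ (T x) y = inner ℝ x (T y)) (hc : IsCompactOperator T) {ε : ℝ}
    (hε : 0 < ε) : ({c : ℝ | ∃ x ≠ 0, T x = c • x} ∩ Ici ε).Finite := by
  by_contra hinf
  have hI : ({c : ℝ | ∃ x ≠ 0, T x = c • x} ∩ Ici ε).Infinite := hinf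
  have := hI.to_subtype
  let u := Infinite.natEmbedding ({c : ℝ | ∃ x ≠ 0, T x = c • x} ∩ Ici ε : Set ℝ)
  have hex : ∀ n, ∃ x : E, ‖x‖ = 1 ∧ T x = (u n : ℝ) • x := fun n => by
    obtain ⟨x, hx0, hx⟩ := (u n).2.1
    refine ⟨‖x‖⁻¹ • x, ?_, ?_⟩
    · rw [norm_smul, norm_inv, norm_norm, inv_mul_cancel₀ (norm_ne_zero_iff.2 hx0)]
    · rw [map_smul, hx, smul_comm]
  choose x hx1 hx using hex
  -- The images of orthonormal eigenvectors with eigenvalues at least `ε` are at distance at least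
  -- `ε` from each other, so no subsequence of them is Cauchy.
  obtain ⟨K, hK, hsub⟩ := hc.image_closedBall_subset_compact (𝕜₁ := ℝ) (f := (T : E →ₗ[ℝ] E)) 1
  obtain ⟨y, -, σ, hσ, hlim⟩ := hK.tendsto_subseq (x := fun n => T (x n)) fun n =>
    hsub ⟨x n, by simp [hx1 n], rfl⟩
  obtain ⟨N, hN⟩ := Metric.cauchySeq_iff.1 hlim.cauchySeq ε hε
  have h1 := hN N le_rfl (N + 1) (Nat.le_succ N)
  have hne : (u (σ N) : ℝ) ≠ u (σ (N + 1)) := fun h =>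
    absurd (hσ.injective (u.injective (Subtype.ext h))) (Nat.succ_ne_self N).symm
  have horth := inner_eq_zero_of_eigen hT hne (hx _) (hx _)
  have hge : ε ≤ u (σ N) := (u (σ N)).2.2
  simp only [Function.comp_apply] at h1
  rw [hx, hx, dist_eq_norm] at h1
  have h2 : ‖(u (σ N) : ℝ) • x (σ N) - (u (σ (N + 1)) : ℝ) • x (σ (N + 1))‖ ^ 2 =
      (u (σ N) : ℝ) ^ 2 + (u (σ (N + 1)) : ℝ) ^ 2 := by
    rw [norm_sub_sq_real, real_inner_smul_left, real_inner_smul_right, horth, norm_smul,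
      norm_smul, hx1, hx1, Real.norm_eq_abs, Real.norm_eq_abs, mul_one, mul_one, sq_abs, sq_abs]
    ring
  have h3 : ‖(u (σ N) : ℝ) • x (σ N) - (u (σ (N + 1)) : ℝ) • x (σ (N + 1))‖ ^ 2 < ε ^ 2 :=
    pow_lt_pow_left₀ h1 (norm_nonneg _) two_ne_zero
  nlinarith [sq_nonneg (u (σ (N + 1)) : ℝ)]

end Spectral

/-- In finite dimension the injective `γ` would be onto; but `γ f` has a continuous representative
vanishing at `B`, so the constant `1` is not attained. -/
theorem not_finiteDimensional_L2I {B : ℝ} (hB : 0 < B) : ¬ FiniteDimensional ℝ (L2I B) := by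
  intro hfd
  have hsurj : Function.Surjective (callOp B : L2I B →ₗ[ℝ] L2I B) :=
    LinearMap.injective_iff_surjective.1 (callOp_injective hB)
  obtain ⟨f, hf⟩ := hsurj (indicatorConstLp 2 MeasurableSet.univ (measure_ne_top _ _) (1 : ℝ))
  have h1 : callFun B f =ᵐ[intervalMeasure B] fun _ => (1 : ℝ) := by
    refine (callOp_coeFn B f).symm.trans ?_
    have h2 : callOp B f =
      indicatorConstLp 2 MeasurableSet.univ (measure_ne_top _ _) (1 : ℝ) := hf
    rw [h2]
    refine indicatorConstLp_coeFn.trans ?_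
    rw [indicator_univ]
  have h2 := Measure.eqOn_Icc_of_ae_eq volume hB.ne h1
    (hasSecondDerivOn_callFun hB f).1.continuousOn continuousOn_const (right_mem_Icc.2 hB.le)
  rw [callFun_right_endpoint] at h2
  exact zero_ne_one h2

theorem exists_singularValueDecomposition {B : ℝ} (hB : 0 < B) :
    ∃ (lam : ℕ → ℝ) (φ ψ : ℕ → L2I B), IsSpectralSystem B lam φ ψ ∧ StrictAnti lam ∧
      ∀ k, callOp B (φ k) = lam k • ψ k ∧ putOp B (ψ k) = lam k • φ k := by
  set T : L2I B →L[ℝ] L2I B := (putOp B).comp (callOp B) with hTdef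
  have hT : ∀ x y, inner ℝ (T x) y = inner ℝ x (T y) := fun x y => by
    simp only [hTdef, ContinuousLinearMap.comp_apply]
    rw [inner_putOp_left, ← inner_callOp_left, inner_callOp_left]
  have hTa : ∀ x, T x = putOp B (callOp B x) := fun _ => rfl
  have hc : IsCompactOperator T := (isCompactOperator_callOp hB).clm_comp (putOp B)
  set S : Set ℝ := {c : ℝ | ∃ x ≠ 0, T x = c • x} with hS
  have hpos : ∀ c ∈ S, 0 < c := by
    rintro c ⟨x, hx0, hx⟩
    have h1 : inner ℝ (callOp B x) (callOp B x) = c * inner ℝ x x := by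
      rw [inner_callOp_left, ← hTa, hx, real_inner_smul_right]
    have h2 : callOp B x ≠ 0 := fun h =>
      hx0 (callOp_injective hB (h.trans (map_zero _).symm))
    have h3 := real_inner_self_pos.2 h2
    rw [h1] at h3
    exact pos_of_mul_pos_left h3 (real_inner_self_pos.2 hx0).le
  have hbot : (⨆ μ, Module.End.eigenspace (T : Module.End ℝ (L2I B)) μ)ᗮ = ⊥ :=
    ContinuousLinearMap.orthogonalComplement_iSup_eigenspaces_eq_bot hc hT
  -- By simplicity, one nonzero eigenvector for each eigenvalue spans all eigenspaces.
  have hle : ∀ (v : ℝ → L2I B), (∀ c ∈ S, v c ≠ 0 ∧ T (v c) = c • v c) →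
      (⨆ μ, Module.End.eigenspace (T : Module.End ℝ (L2I B)) μ) ≤ Submodule.span ℝ (v '' S) := by
    intro v hv
    refine iSup_le fun c x hx => ?_
    have hx' : T x = c • x := Module.End.mem_eigenspace_iff.1 hx
    by_cases hx0 : x = 0
    · rw [hx0]; exact Submodule.zero_mem _
    · have hcS : c ∈ S := ⟨x, hx0, hx'⟩
      obtain ⟨a, rfl⟩ := exists_smul_eq_of_eigen_left hB (hpos c hcS) (hv c hcS).1 (hv c hcS).2 hx'
      exact Submodule.smul_mem _ _ (Submodule.subset_span ⟨c, hcS, rfl⟩)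
  have hex : ∀ c, ∃ v : L2I B, c ∈ S → ‖v‖ = 1 ∧ T v = c • v := fun c => by
    by_cases hcS : c ∈ S
    · obtain ⟨x, hx0, hx⟩ := hcS
      refine ⟨‖x‖⁻¹ • x, fun _ => ⟨?_, ?_⟩⟩
      · rw [norm_smul, norm_inv, norm_norm, inv_mul_cancel₀ (norm_ne_zero_iff.2 hx0)]
      · rw [map_smul, hx, smul_comm]
    · exact ⟨0, fun h => absurd h hcS⟩
  choose v hv using hex
  have hspan := hle v fun c hcS =>
    ⟨fun h => by simpa [h] using (hv c hcS).1, (hv c hcS).2⟩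
  have hspbot : (Submodule.span ℝ (v '' S))ᗮ = ⊥ :=
    eq_bot_iff.2 (hbot ▸ Submodule.orthogonal_le hspan)
  -- With finitely many eigenvalues the span would be finite-dimensional, hence closed, and with
  -- trivial orthogonal complement it would be the whole space.
  have hinf : S.Infinite := by
    intro hfin
    have : FiniteDimensional ℝ (Submodule.span ℝ (v '' S)) :=
      FiniteDimensional.span_of_finite ℝ (hfin.image v)
    have htop : Submodule.span ℝ (v '' S) = ⊤ := Submodule.orthogonal_eq_bot_iff.1 hspbot
    refine not_finiteDimensional_L2I hB ?_
    rw [htop] at this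
    exact Submodule.topEquiv.finiteDimensional
  obtain ⟨u, hu, hur⟩ := exists_strictAnti_range_eq hinf hpos
    fun ε hε => finite_eigenvalues_ge hT hc hε
  have huS : ∀ k, u k ∈ S := fun k => hur ▸ mem_range_self k
  have hup : ∀ k, 0 < u k := fun k => hpos _ (huS k)
  have hsq : ∀ k, √(u k) ^ 2 = u k := fun k => Real.sq_sqrt (hup k).le
  have hlp : ∀ k, 0 < √(u k) := fun k => Real.sqrt_pos.2 (hup k)
  have heig : ∀ k, putOp B (callOp B (v (u k))) = u k • v (u k) := fun k => (hv _ (huS k)).2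
  have hon : Orthonormal ℝ fun k => v (u k) :=
    ⟨fun k => (hv _ (huS k)).1, fun i j hij =>
      inner_eq_zero_of_eigen hT (hu.injective.ne hij) (heig i) (heig j)⟩
  -- Since `u k` is an eigenvalue of `γ*γ`, the singular value is `√(u k)`, and `ψ_k` is defined as
  -- `λ_k⁻¹ γ φ_k`.
  have hcall : ∀ k, callOp B (v (u k)) = √(u k) • ((√(u k))⁻¹ • callOp B (v (u k))) := fun k => by
    rw [smul_smul, mul_inv_cancel₀ (hlp k).ne', one_smul]
  have hput : ∀ k, putOp B ((√(u k))⁻¹ • callOp B (v (u k))) = √(u k) • v (u k) := fun k => by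
    rw [map_smul, heig, smul_smul]
    congr 1
    rw [inv_mul_eq_iff_eq_mul₀ (hlp k).ne', ← pow_two, hsq]
  have hrange : range (fun k => v (u k)) = v '' S := by
    rw [← hur, ← range_comp]; rfl
  have htop : (Submodule.span ℝ (range fun k => v (u k))).topologicalClosure = ⊤ := by
    rw [hrange]
    exact Submodule.topologicalClosure_eq_top_iff.2 hspbot
  refine ⟨fun k => √(u k), fun k => v (u k), fun k => (√(u k))⁻¹ • callOp B (v (u k)),
    ⟨hlp, ?_, hon, ⟨fun k => ?_, fun i j hij => ?_⟩, ?_, ?_, ?_, ?_⟩, ?_,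
    fun k => ⟨hcall k, hput k⟩⟩
  · exact fun i j hij => Real.sqrt_le_sqrt (hu.antitone hij)
  · have h1 : ‖callOp B (v (u k))‖ ^ 2 = √(u k) ^ 2 := by
      rw [← real_inner_self_eq_norm_sq, inner_callOp_left, heig, real_inner_smul_right,
        real_inner_self_eq_norm_sq, (hv _ (huS k)).1, hsq, one_pow, mul_one]
    have h2 := (pow_left_inj₀ (norm_nonneg _) (hlp k).le two_ne_zero).1 h1
    rw [norm_smul, h2, norm_inv, Real.norm_of_nonneg (hlp k).le, inv_mul_cancel₀ (hlp k).ne']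
  · beta_reduce
    rw [real_inner_smul_left, real_inner_smul_right, inner_callOp_left, heig,
      real_inner_smul_right]
    have := hon.2 hij
    rw [this]
    ring
  · exact fun k => by rw [heig, hsq]
  · exact fun k => by
      rw [hput, map_smul, pow_two, mul_smul]
      exact congrArg _ (hcall k)
  · intro f
    rw [htop]
    trivial
  · intro f
    -- `γ* f` is a limit of combinations of the `φ_k`, which `γ` maps continuously to combinations
    -- of the `ψ_k`.
    have hmem : putOp B f ∈ (Submodule.span ℝ (range fun k => v (u k))).topologicalClosure := by
      rw [htop]; trivial
    refine map_mem_closure (callOp B).continuous hmem fun y hy => ?_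
    refine Submodule.span_induction ?_ ?_ ?_ ?_ hy
    · rintro _ ⟨k, rfl⟩
      rw [hcall k]
      exact Submodule.smul_mem _ _ (Submodule.subset_span ⟨k, rfl⟩)
    · rw [map_zero]; exact Submodule.zero_mem _
    · intro x y _ _ hx hy
      rw [map_add]; exact Submodule.add_mem _ hx hy
    · intro a x _ hx
      rw [map_smul]; exact Submodule.smul_mem _ _ hx
  · exact fun i j hij => Real.sqrt_lt_sqrt (hup j).le (hu hij)

theorem mainTheorem3 (B : ℝ) (hB : 0 < B) :
    -- `γ*` is the adjoint of `γ`
    putOp B = ContinuousLinearMap.adjoint (callOp B) ∧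
    -- existence of the singular value decomposition, with strictly decreasing singular values
    (∃ (lam : ℕ → ℝ) (φ ψ : ℕ → L2I B), IsSpectralSystem B lam φ ψ ∧ StrictAnti lam ∧
      ∀ k, callOp B (φ k) = lam k • ψ k ∧ putOp B (ψ k) = lam k • φ k) ∧
    -- every pair of eigenbases given by the spectral theorem, signs being matched, is such a
    -- decomposition, and yields the spectral expansions
    (∀ (lam : ℕ → ℝ) (φ ψ : ℕ → L2I B), IsSpectralSystem B lam φ ψ →
      (∀ k, 0 ≤ inner ℝ (callOp B (φ k)) (ψ k)) →
      (∀ k, callOp B (φ k) = lam k • ψ k ∧ putOp B (ψ k) = lam k • φ k) ∧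
      ∀ f : L2I B,
        HasSum (fun k => inner ℝ f (φ k) • φ k) f ∧
        HasSum (fun k => (lam k * inner ℝ f (φ k)) • ψ k) (callOp B f) ∧
        HasSum (fun k => inner ℝ f (ψ k) • ψ k) f ∧
        HasSum (fun k => (lam k * inner ℝ f (ψ k)) • φ k) (putOp B f)) ∧
    -- regularity of the ranges, and the second derivative of `γ f` and of `γ* f` is `f`
    (∀ f : L2I B, HasSecondDerivOn B (callFun B f) f ∧ HasSecondDerivOn B (putFun B f) f) ∧
    -- if `f` is continuous on `[0, B]`, the same holds classically, at every point
    (∀ (f : L2I B) (h : ℝ → ℝ), ContinuousOn h (Icc 0 B) → f =ᵐ[intervalMeasure B] h →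
      (ContDiffOn ℝ 2 (callFun B f) (Icc 0 B) ∧
        ∀ ξ ∈ Icc 0 B, iteratedDerivWithin 2 (callFun B f) (Icc 0 B) ξ = h ξ) ∧
      (ContDiffOn ℝ 2 (putFun B f) (Icc 0 B) ∧
        ∀ ξ ∈ Icc 0 B, iteratedDerivWithin 2 (putFun B f) (Icc 0 B) ξ = h ξ)) ∧
    -- dense ranges
    DenseRange (callOp B) ∧ DenseRange (putOp B) ∧
    -- invertibility on the range, with the second derivative as inverse
    Function.Injective (callOp B) ∧ Function.Injective (putOp B) ∧
    (∀ (u v : L2I B) (g : ℝ → ℝ), u ∈ range (callOp B) → u =ᵐ[intervalMeasure B] g →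
      HasSecondDerivOn B g v → callOp B v = u) ∧
    (∀ (u v : L2I B) (g : ℝ → ℝ), u ∈ range (putOp B) → u =ᵐ[intervalMeasure B] g →
      HasSecondDerivOn B g v → putOp B v = u) ∧
    -- put-call parity on the interval
    (∀ f : L2I B, ∀ ξ ∈ Icc 0 B,
      callFun B f ξ - putFun B f ξ = partialMoment B 1 f - ξ * partialMoment B 0 f) ∧
    (∀ f : L2I B, (callOp B - putOp B) f =ᵐ[intervalMeasure B]
      fun ξ => partialMoment B 1 f - ξ * partialMoment B 0 f) := by
  refine ⟨putOp_eq_adjoint B, exists_singularValueDecomposition hB, ?_,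
    fun f => ⟨hasSecondDerivOn_callFun hB f, hasSecondDerivOn_putFun hB f⟩, ?_,
    denseRange_callOp hB, denseRange_putOp hB, callOp_injective hB, putOp_injective hB,
    fun _ _ _ => callOp_eq_of_hasSecondDerivOn hB, fun _ _ _ => putOp_eq_of_hasSecondDerivOn hB,
    fun f ξ _ => callFun_sub_putFun (L2I.integrable f) ξ, ?_⟩
  · intro lam φ ψ h hk
    have hcall := fun k => h.callOp_eq hB (hk k)
    have hput := fun k => h.putOp_eq hB (hk k)
    have hφ := h.top_le_span_left hB
    have hψ := h.top_le_span_right hB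
    exact ⟨fun k => ⟨hcall k, hput k⟩, fun f =>
      ⟨hasSum_inner_smul h.orthonormal_left hφ f,
        hasSum_map_inner_smul h.orthonormal_left hφ hcall f,
        hasSum_inner_smul h.orthonormal_right hψ f,
        hasSum_map_inner_smul h.orthonormal_right hψ hput f⟩⟩
  · intro f h hh hfh
    exact ⟨contDiffOn_two_of_hasDerivAt hB
        (fun _ hξ => hasDerivAt_callFun (L2I.integrable f) hξ) hh hfh,
      contDiffOn_two_of_hasDerivAt (c := 0) hB
        (fun _ hξ => by simpa using hasDerivAt_putFun (L2I.integrable f) hξ) hh hfh⟩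
  · intro f
    rw [sub_apply]
    filter_upwards [Lp.coeFn_sub (callOp B f) (putOp B f), callOp_coeFn B f,
      putOp_coeFn B f] with ξ h1 h2 h3
    rw [h1, Pi.sub_apply, h2, h3, callFun_sub_putFun (L2I.integrable f) ξ]
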